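/- Let $M$ be a compact metric space. Then the following are equivalent: (1) the covering dimension $\dim M$ is finite, i.e. $\dim M<\infty$; (2) there is a total order $T$ on $M$ with $\mathrm{Snake}(M,T)<\infty$. Here $\dim M\le n$ (for an integer $n\ge -1$) means that every finite open cover of $M$ has a finite open refinement (again a cover of $M$) of order at most $n$, i.e. one in which no $n+2$ distinct members have a common point. Furthermore $\dim M$ is the least such $n\geq -1$, and $\dim M=\infty$ if there is none (so $\dim\emptyset=-1$, which counts as finite). For a total order $T$ on $M$ and $U_1,U_2\subseteq M$, the ordered pair $(U_1,U_2)$ contains a snake of length $s\in\{0,1,2,\dots\}$ if there are points $a_0<_T a_1<_T\dots<_T a_s$ of $M$ such that $a_i\in U_1$ for all even $i$ and $a_i\in U_2$ for all odd $i$. For distinct $x,y\in M$, $\mathrm{Snake}_T(x,y)$ is the greatest $s$ such that for every $\varepsilon>0$ the pair of open balls $(B_\varepsilon(x),B_\varepsilon(y))$ contains a snake of length $s$, and it is $\infty$ if there is no greatest such $s$. Finally $\mathrm{Snake}(M,T)=\sup_{x\ne y}\mathrm{Snake}_T(x,y)$, where the supremum over the empty set is $0$. -/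

import Mathlib

/-- The ordered pair `(U₁, U₂)` contains a snake of length `s`: there are `a₀ <_T a₁ <_T ⋯ <_T a_s`
with all even-indexed points in `U₁` and all odd-indexed points in `U₂`. -/
def ContainsSnake {M : Type*} (T : LinearOrder M) (U₁ U₂ : Set M) (s : ℕ) : Prop :=
  ∃ a : Fin (s + 1) → M,
    (∀ i j : Fin (s + 1), i < j → T.lt (a i) (a j)) ∧
    (∀ i : Fin (s + 1), Even (i : ℕ) → a i ∈ U₁) ∧
    (∀ i : Fin (s + 1), Odd (i : ℕ) → a i ∈ U₂)

/-- The snake number of a pair of points: the greatest `s` such that for every `ε > 0` the pair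
`(B_ε(x), B_ε(y))` contains a snake of length `s`, and `⊤` if there is no greatest such `s`.
(The number `0` always qualifies, so the supremum is taken over a nonempty set.) -/
noncomputable def pairSnakeNumber {M : Type*} [MetricSpace M] (T : LinearOrder M) (x y : M) : ℕ∞ :=
  ⨆ (s : ℕ) (_ : ∀ ε : ℝ, 0 < ε → ContainsSnake T (Metric.ball x ε) (Metric.ball y ε) s), (s : ℕ∞)

/-- The snake number of the ordered metric space `(M, T)`: the supremum over all ordered pairs of
distinct points. -/
noncomputable def snakeNumber (M : Type*) [MetricSpace M] (T : LinearOrder M) : ℕ∞ :=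
  ⨆ (x : M) (y : M) (_ : x ≠ y), pairSnakeNumber T x y

/-- The order of a family of sets: the largest integer `n` such that the family contains `n + 1`
distinct sets with a nonempty intersection, `⊤` if there are such `n` of any size. The value `⊥`
stands for `-1`: no member of the family is nonempty. -/
noncomputable def familyOrder {X : Type*} (A : Set (Set X)) : WithBot ℕ∞ :=
  ⨆ (n : ℕ) (_ : ∃ F : Finset (Set X), (F : Set (Set X)) ⊆ A ∧ F.card = n + 1 ∧
      (⋂₀ (F : Set (Set X))).Nonempty), ((n : ℕ∞) : WithBot ℕ∞)

/-- A finite family of open sets that covers the space. -/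
structure IsFiniteOpenCover {X : Type*} [TopologicalSpace X] (A : Set (Set X)) : Prop where
  finite : A.Finite
  isOpen : ∀ U ∈ A, IsOpen U
  covers : ⋃₀ A = Set.univ

/-- `dim X ≤ n` (with `⊥` standing for `-1`): every finite open cover of `X` has a finite open
refinement of order at most `n`. -/
def CoveringDimLE (X : Type*) [TopologicalSpace X] (n : WithBot ℕ∞) : Prop :=
  ∀ A : Set (Set X), IsFiniteOpenCover A →
    ∃ B : Set (Set X), IsFiniteOpenCover B ∧ (∀ V ∈ B, ∃ U ∈ A, V ⊆ U) ∧ familyOrder B ≤ n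

/-- The covering dimension: the least `n` with `dim X ≤ n`, where `⊥` stands for `-1` and `⊤` for
infinite dimension. -/
noncomputable def coveringDim (X : Type*) [TopologicalSpace X] : WithBot ℕ∞ :=
  sInf {n : WithBot ℕ∞ | CoveringDimLE X n}

/-! A finite snake number bounds the dimension through obstruction theory. Let K be the nonconstant
vectors of ℝ^(N+1), up to homotopy a sphere S^(N-1). If M is an extensor for K for all N ≥ m, then a
map to the nerve of a cover can be pushed off its simplices of high dimension
(`exists_coveringFamily_eliminate`), so dim M ≤ m. If M is not an extensor for some N, take a
minimal closed D over which some f does not extend. For each initial segment J of T, the closures of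
J and of its complement cover D, and extensions over the two halves glue once they are homotopic
over the common part (`ExtendsOver.union`). So either the obstruction passes to the common part
times an interval for some J, or D lies in exactly one of the two closures for every J. In the
latter case the resulting cut of T yields snakes of all lengths
(`exists_split_or_forall_containsSnake`). Every split adds a point to a snake, and splitting can go
on while the cube factor has dimension below N, so failure for N forces snakes of length N - 1.

Conversely, if dim M ≤ n, choose finite covers of multiplicity at most n + 1 with mesh tending to 0,
give each point a compatible sequence of members around it, and order the points lexicographically
by these codes. Points sharing a member at some level form a convex set. A snake of length 2n + 2
near x and y would thus have n + 2 distinct members around x at its even points, since a repetition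
would trap an odd point, near y, in a member containing x. -/

/-- The pair `(P, f)` extends over `S` relative to `K`: some continuous map on the whole space
agrees with `f` on `P` and maps `S` into `K`. -/
def ExtendsOver {Y E : Type*} [TopologicalSpace Y] [TopologicalSpace E] (K : Set E) (P : Set Y)
    (f : C(Y, E)) (S : Set Y) : Prop :=
  ∃ g : C(Y, E), Set.EqOn g f P ∧ Set.MapsTo g S K

/-- Every continuous map that sends a closed set `P` into `K` can be changed off `P` so that it
sends `S` into `K`. -/
def IsExtensor {Y E : Type*} [TopologicalSpace Y] [TopologicalSpace E] (K : Set E)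
    (S : Set Y) : Prop :=
  ∀ (P : Set Y) (f : C(Y, E)), IsClosed P → Set.MapsTo f P K → ExtendsOver K P f S

/-! ### Extending maps and gluing extensions along homotopies. -/

section Extension

open Set Topology unitInterval

variable {Y Z E : Type*} [TopologicalSpace Y] [TopologicalSpace Z] {K : Set E}

theorem ExtendsOver.mono [TopologicalSpace E] {P : Set Y} {f : C(Y, E)} {S S' : Set Y}
    (h : ExtendsOver K P f S') (hS : S ⊆ S') : ExtendsOver K P f S :=
  let ⟨g, h1, h2⟩ := h
  ⟨g, h1, h2.mono_left hS⟩

/-- Extensor properties pass to retracts; this is how cube factors are dropped or rearranged. -/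
theorem IsExtensor.of_leftInverse [TopologicalSpace E] {S : Set Y} {S' : Set Z} (a : C(Y, Z))
    (b : C(Z, Y)) (hba : ∀ y, b (a y) = y) (haS : MapsTo a S S') (h : IsExtensor K S') :
    IsExtensor K S := by
  intro P f hP hf
  obtain ⟨g, hg, hgS⟩ := h (b ⁻¹' P) (f.comp b) (hP.preimage b.continuous) (fun z hz => hf hz)
  refine ⟨g.comp a, fun y hy => ?_, fun y hy => hgS (haS hy)⟩
  have := hg (show a y ∈ b ⁻¹' P by simpa [hba] using hy)
  simpa [hba] using this

/-- Two maps into `ℝ^ι` that agree on the intersection of two closed sets glue to a map on the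
whole space. -/
theorem exists_continuousMap_eqOn_union {ι : Type*} [NormalSpace Y] {A B : Set Y} (hA : IsClosed A)
    (hB : IsClosed B) (f g : C(Y, ι → ℝ)) (h : EqOn f g (A ∩ B)) :
    ∃ F : C(Y, ι → ℝ), EqOn F f A ∧ EqOn F g B := by
  classical
  have hF : ContinuousOn (A.piecewise f g) (A ∪ B) := by
    refine ContinuousOn.union_of_isClosed ?_ ?_ hA hB
    · exact f.continuous.continuousOn.congr (piecewise_eqOn A f g)
    · refine g.continuous.continuousOn.congr fun x hx => ?_
      by_cases hxA : x ∈ A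
      · rw [piecewise_eq_of_mem _ _ _ hxA, h ⟨hxA, hx⟩]
      · rw [piecewise_eq_of_notMem _ _ _ hxA]
  obtain ⟨F, hF'⟩ := ContinuousMap.exists_restrict_eq (hA.union hB)
    (⟨_, hF.domRestrict⟩ : C(↥(A ∪ B), ι → ℝ))
  have key : ∀ x ∈ A ∪ B, F x = A.piecewise f g x := fun x hx => by
    have := DFunLike.congr_fun hF' ⟨x, hx⟩
    simpa using this
  refine ⟨F, fun x hx => ?_, fun x hx => ?_⟩
  · rw [key x (.inl hx), piecewise_eq_of_mem _ _ _ hx]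
  · rw [key x (.inr hx)]
    by_cases hxA : x ∈ A
    · rw [piecewise_eq_of_mem _ _ _ hxA, h ⟨hxA, hx⟩]
    · rw [piecewise_eq_of_notMem _ _ _ hxA]

/-- If the restriction of `g` to the closed set `C` deforms inside the open set `K`, then `g` can be
changed to the end of the deformation on `C` without leaving `K` where it was in `K` before. -/
theorem exists_eqOn_of_homotopy {ι : Type*} [NormalSpace Y] {K : Set (ι → ℝ)}
    (hK : IsOpen K) {C : Set Y} (hC : IsClosed C) (g : C(Y, ι → ℝ)) (h : C(Y × I, ι → ℝ))
    (h0 : ∀ y ∈ C, h (y, 0) = g y) (hh : ∀ y ∈ C, ∀ t, h (y, t) ∈ K) :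
    ∃ g' : C(Y, ι → ℝ), (∀ y ∈ C, g' y = h (y, 1)) ∧ ∀ y, g y ∈ K → g' y ∈ K := by
  -- The correction makes the homotopy start at `g` on all of `Y`, leaving it unchanged over `C`.
  let H : C(Y × I, ι → ℝ) :=
    ⟨fun p => h p + (g p.1 - h (p.1, 0)), by fun_prop⟩
  -- Points whose whole track stays in `K`: an open set, by compactness of `I`.
  let V : Set Y := (Prod.fst '' (H ⁻¹' K)ᶜ)ᶜ
  have hV : IsOpen V :=
    (isClosedMap_fst_of_compactSpace _ (hK.preimage H.continuous).isClosed_compl).isOpen_compl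
  have hVmem : ∀ y ∈ V, ∀ t, H (y, t) ∈ K := by
    intro y hy t
    by_contra hcon
    exact hy ⟨(y, t), hcon, rfl⟩
  have hCV : Disjoint Vᶜ C := by
    rw [Set.disjoint_left]
    rintro y hy hyC
    obtain ⟨⟨y', t⟩, hcon, rfl⟩ := not_not.1 hy
    apply hcon
    simpa [H, h0 _ hyC] using hh _ hyC t
  obtain ⟨u, hu0, hu1, hu⟩ := exists_continuous_zero_one_of_isClosed hV.isClosed_compl hC hCV
  let u' : C(Y, I) := ⟨fun y => ⟨u y, hu y⟩, by fun_prop⟩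
  refine ⟨⟨fun y => H (y, u' y), by fun_prop⟩, fun y hy => ?_, fun y hy => ?_⟩
  · have : u' y = 1 := Subtype.ext (hu1 hy)
    simp [this, H, h0 y hy]
  · by_cases hyV : y ∈ V
    · exact hVmem y hyV _
    · have : u' y = 0 := Subtype.ext (hu0 hyV)
      simpa [this, H] using hy

/-- A Mayer–Vietoris step. The straight-line homotopy between the two extensions is corrected to run
inside `K` over `S ∩ T`; then one extension is deformed to match the other there. -/
theorem ExtendsOver.union {ι : Type*} [NormalSpace Y] {K : Set (ι → ℝ)} (hK : IsOpen K)
    {S T P : Set Y} (hS : IsClosed S) (hT : IsClosed T) (hP : IsClosed P) {f : C(Y, ι → ℝ)}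
    (hf : MapsTo f P K) (h1 : ExtendsOver K P f S) (h2 : ExtendsOver K P f T)
    (h : IsExtensor K ((S ∩ T) ×ˢ (univ : Set I))) : ExtendsOver K P f (S ∪ T) := by
  obtain ⟨g1, hg1, hg1S⟩ := h1
  obtain ⟨g2, hg2, hg2T⟩ := h2
  let F : C(Y × I, ι → ℝ) :=
    ⟨fun p => (1 - (p.2 : ℝ)) • g1 p.1 + (p.2 : ℝ) • g2 p.1, by fun_prop⟩
  have hF0 : ∀ y, F (y, 0) = g1 y := fun y => by simp [F]
  have hF1 : ∀ y, F (y, 1) = g2 y := fun y => by simp [F]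
  have hFP : ∀ y ∈ P, ∀ t, F (y, t) = f y := fun y hy t => by
    simp [F, hg1 hy, hg2 hy, ← add_smul]
  obtain ⟨h, hhF, hhK⟩ := h (P ×ˢ univ ∪ (S ∩ T) ×ˢ {0, 1}) F
    ((hP.prod isClosed_univ).union
      ((hS.inter hT).prod (Set.toFinite {(0 : I), 1}).isClosed)) (by
      rintro ⟨y, t⟩ (⟨hy, -⟩ | ⟨hy, rfl | rfl⟩)
      · rw [hFP y hy]; exact hf hy
      · rw [hF0]; exact hg1S hy.1
      · rw [hF1]; exact hg2T hy.2)
  have hP' : ∀ y ∈ P, ∀ t, h (y, t) = f y := fun y hy t => by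
    rw [hhF (.inl ⟨hy, mem_univ _⟩), hFP y hy]
  obtain ⟨g, hg, hgK⟩ := exists_eqOn_of_homotopy hK (hP.union (hS.inter hT)) g1 h (by
      rintro y (hy | hy)
      · rw [hP' y hy, hg1 hy]
      · rw [hhF (.inr ⟨hy, by simp⟩), hF0]) (by
      rintro y (hy | hy) t
      · rw [hP' y hy]; exact hf hy
      · exact hhK ⟨hy, mem_univ _⟩)
  have hgP : ∀ y ∈ P, g y = f y := fun y hy => by rw [hg y (.inl hy), hP' y hy]
  obtain ⟨G, hG1, hG2⟩ := exists_continuousMap_eqOn_union (hP.union hS) hT g g2 (by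
    rintro y ⟨hy | hy, hyT⟩
    · rw [hgP y hy, hg2 hy]
    · rw [hg y (.inr ⟨hy, hyT⟩), hhF (.inr ⟨⟨hy, hyT⟩, by simp⟩), hF1])
  refine ⟨G, fun y hy => ?_, ?_⟩
  · rw [hG1 (.inl hy), hgP y hy]
  · rintro y (hy | hy)
    · rw [hG1 (.inr hy)]; exact hgK y (hg1S hy)
    · rw [hG2 hy]; exact hg2T hy

end Extension

/-! ### Cylinders over closed subsets and minimal obstructed sets. -/

section Cylinder

open Set Topology unitInterval

variable {M : Type*} [MetricSpace M]

/-- The cylinder of height dimension `k` over a subset of `M`. -/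
def cylinder (k : ℕ) (D : Set M) : Set (M × (Fin k → I)) := Prod.fst ⁻¹' D

theorem IsClosed.cylinder {D : Set M} (hD : IsClosed D) (k : ℕ) : IsClosed (cylinder k D) :=
  hD.preimage continuous_fst

theorem isExtensor_cylinder_of_succ {E : Type*} [TopologicalSpace E] {K : Set E} {k : ℕ} {D : Set M}
    (h : IsExtensor K (cylinder (k + 1) D)) : IsExtensor K (cylinder k D) :=
  h.of_leftInverse ⟨fun y => (y.1, Fin.cons 0 y.2), by fun_prop⟩
    ⟨fun y => (y.1, Fin.tail y.2), by unfold Fin.tail; fun_prop⟩ (by simp) fun _ hy => hy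

theorem isExtensor_cylinder_prod {E : Type*} [TopologicalSpace E] {K : Set E} {k : ℕ} {D : Set M}
    (h : IsExtensor K (cylinder (k + 1) D)) :
    IsExtensor K (cylinder k D ×ˢ (univ : Set I)) :=
  h.of_leftInverse ⟨fun y => (y.1.1, Fin.cons y.2 y.1.2), by fun_prop⟩
    ⟨fun y => ((y.1, Fin.tail y.2), y.2 0), by unfold Fin.tail; fun_prop⟩ (by simp)
    fun _ hy => hy.1

theorem ExtendsOver.cylinder_union {ι : Type*} {K : Set (ι → ℝ)} (hK : IsOpen K) {k : ℕ}
    {S T : Set M} {P : Set (M × (Fin k → I))} (hS : IsClosed S) (hT : IsClosed T)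
    (hP : IsClosed P) {f : C(M × (Fin k → I), ι → ℝ)} (hf : MapsTo f P K)
    (h1 : ExtendsOver K P f (cylinder k S)) (h2 : ExtendsOver K P f (cylinder k T))
    (h : IsExtensor K (cylinder (k + 1) (S ∩ T))) :
    ExtendsOver K P f (cylinder k (S ∪ T)) :=
  ExtendsOver.union hK (hS.cylinder k) (hT.cylinder k) hP hf h1 h2 (isExtensor_cylinder_prod h)

theorem isExtensor_cylinder_empty {E : Type*} [TopologicalSpace E] (K : Set E) (k : ℕ) :
    IsExtensor K (cylinder k (∅ : Set M)) :=
  fun _ f _ _ => ⟨f, fun _ _ => rfl, fun _ hy => hy.elim⟩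

/-- Zorn's lemma applies because an extension over the intersection of a chain already works over a
member: the points of `M` with a bad value above them form a compact set missing the intersection.
-/
theorem exists_minimal_not_extendsOver [CompactSpace M] {E : Type*} [TopologicalSpace E]
    {K : Set E} (hK : IsOpen K) {k : ℕ} {P : Set (M × (Fin k → I))} {f : C(M × (Fin k → I), E)}
    {D : Set M} (hD : IsClosed D) (h : ¬ ExtendsOver K P f (cylinder k D)) :
    ∃ D' ⊆ D, IsClosed D' ∧ ¬ ExtendsOver K P f (cylinder k D') ∧
      ∀ D'' ⊆ D', IsClosed D'' → D'' ≠ D' → ExtendsOver K P f (cylinder k D'') := by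
  obtain ⟨m, hm, hmin⟩ := zorn_superset_nonempty
    {D : Set M | IsClosed D ∧ ¬ ExtendsOver K P f (cylinder k D)} (by
      intro c hc hch hne
      refine ⟨⋂₀ c, ⟨isClosed_sInter fun s hs => (hc hs).1, ?_⟩, fun s hs => sInter_subset_of_mem hs⟩
      rintro ⟨g, hg, hgK⟩
      have hcl : IsClosed (Prod.fst '' (g ⁻¹' K)ᶜ : Set M) :=
        isClosedMap_fst_of_compactSpace _ (hK.preimage g.continuous).isClosed_compl
      have hdir : Directed (· ⊇ ·) (fun s : c => (s : Set M)) := by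
        intro a b
        rcases hch.total a.2 b.2 with h | h
        · exact ⟨a, subset_rfl, h⟩
        · exact ⟨b, h, subset_rfl⟩
      have := hne.to_subtype
      obtain ⟨⟨s, hs⟩, hs'⟩ := hcl.isCompact.elim_directed_family_closed
        (fun s : c => (s : Set M)) (fun s => (hc s.2).1) (by
          rw [← sInter_eq_iInter]
          apply disjoint_iff_inter_eq_empty.1
          rw [Set.disjoint_left]
          rintro _ ⟨y, hy, rfl⟩ hyc
          exact hy (hgK hyc)) hdir
      refine (hc hs).2 ⟨g, hg, fun y hy => ?_⟩
      by_contra hcon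
      have : y.1 ∈ (Prod.fst '' (g ⁻¹' K)ᶜ : Set M) ∩ s := ⟨⟨y, hcon, rfl⟩, hy⟩
      simp only at hs'
      rw [hs'] at this
      exact this) D ⟨hD, h⟩
  refine ⟨m, hm, hmin.prop.1, hmin.prop.2, fun D'' hsub hcl hne => ?_⟩
  by_contra hcon
  exact hne (hmin.eq_of_subset ⟨hcl, hcon⟩ hsub)

end Cylinder

/-! ### General position: cubes of dimension below N carry no obstruction. -/

section Nonconstant

open Set Topology unitInterval

/-- The nonconstant vectors in `ℝ^(N+1)`. -/
def nonconstantVectors (N : ℕ) : Set (Fin (N + 1) → ℝ) := {v | ∃ i j, v i ≠ v j}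

theorem isOpen_nonconstantVectors (N : ℕ) : IsOpen (nonconstantVectors N) := by
  have : nonconstantVectors N = ⋃ i, ⋃ j, {v | v i ≠ v j} := by
    ext v; simp [nonconstantVectors]
  rw [this]
  exact isOpen_iUnion fun i => isOpen_iUnion fun j =>
    isOpen_ne_fun (continuous_apply i) (continuous_apply j)

theorem exists_approx_mem_nonconstantVectors {k N : ℕ} (hk : k < N)
    (f : C(Fin k → I, Fin (N + 1) → ℝ)) {ε : ℝ} (hε : 0 < ε) :
    ∃ p : C(Fin k → I, Fin (N + 1) → ℝ),
      ∀ q, dist (p q) (f q) < ε ∧ p q ∈ nonconstantVectors N := by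
  let r : (Fin k → ℝ) → (Fin k → I) := fun v i => projIcc 0 1 zero_le_one (v i)
  have hr : Continuous r := by
    refine continuous_pi fun i => ?_
    exact continuous_projIcc.comp (continuous_apply i)
  obtain ⟨g, hg, hgf, -⟩ := Continuous.exists_contDiff_approx 1 (f.continuous.comp hr)
    (ε := fun _ => ε / 2) continuous_const (fun _ => half_pos hε)
  -- The smooth map (z, t) ↦ g z - t(1, …, 1) has a source of dimension k + 1 < N + 1, so a small
  -- translation moves `g` off the diagonal.
  have hdense := ContDiff.dense_compl_range_of_finrank_lt_finrank
    (f := fun z : (Fin k → ℝ) × ℝ => (g z.1 - fun _ => z.2 : Fin (N + 1) → ℝ)) (by fun_prop)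
    (by simp; omega)
  obtain ⟨c, hc, hc0⟩ := Metric.dense_iff.1 hdense 0 (ε / 2) (half_pos hε)
  have hinc : Continuous fun q : Fin k → I => (fun i => (q i : ℝ)) := by fun_prop
  refine ⟨⟨fun q => g (fun i => q i) - c, (hg.continuous.comp hinc).sub continuous_const⟩,
    fun q => ⟨?_, ?_⟩⟩
  · have h1 := hgf (fun i => q i)
    have h2 : r (fun i => q i) = q := by
      funext i; simp [r]
    simp only [Function.comp_apply, h2] at h1
    have h3 : dist (g (fun i => q i) - c) (g fun i => q i) < ε / 2 := by
      rw [dist_eq_norm]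
      simpa using hc
    calc _ ≤ _ := dist_triangle _ _ _
      _ < _ := add_lt_add h3 h1
      _ = ε := by ring
  · by_contra hcon
    simp only [nonconstantVectors, mem_ofPred_eq, not_exists, not_not, ContinuousMap.coe_mk] at hcon
    refine hc0 ⟨(fun i => q i, (g (fun i => q i) - c) 0), ?_⟩
    funext i
    have := hcon i 0
    simp only [Pi.sub_apply] at this ⊢
    linarith

theorem exists_eqOn_forall_mem_nonconstantVectors {k N : ℕ} (hk : k < N)
    (f : C(Fin k → I, Fin (N + 1) → ℝ)) {P : Set (Fin k → I)} (hP : IsClosed P)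
    (hf : MapsTo f P (nonconstantVectors N)) :
    ∃ g : C(Fin k → I, Fin (N + 1) → ℝ), EqOn g f P ∧ ∀ q, g q ∈ nonconstantVectors N := by
  obtain ⟨ε, hε, hεK⟩ := (hP.isCompact.image f.continuous).exists_thickening_subset_open
    (isOpen_nonconstantVectors N) (image_subset_iff.2 hf)
  obtain ⟨p, hp⟩ := exists_approx_mem_nonconstantVectors hk f (half_pos hε)
  let V : Set (Fin k → I) := f ⁻¹' Metric.thickening (ε / 2) (f '' P)
  have hV : IsOpen V := Metric.isOpen_thickening.preimage f.continuous
  have hPV : P ⊆ V := fun q hq =>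
    Metric.self_subset_thickening (half_pos hε) _ (mem_image_of_mem f hq)
  obtain ⟨u, hu0, hu1, hu⟩ := exists_continuous_zero_one_of_isClosed hP hV.isClosed_compl
    (disjoint_compl_right_iff_subset.2 hPV)
  -- Near `P` both errors are below `ε / 2`, which keeps the values in the `ε`-thickening of `f ''
  -- P`; away from `P` the map is `p`.
  refine ⟨⟨fun q => f q + u q • (p q - f q), by fun_prop⟩, fun q hq => ?_, fun q => ?_⟩
  · simp [hu0 hq]
  · by_cases hq : q ∈ V
    · apply hεK
      obtain ⟨z, hz, hzq⟩ := Metric.mem_thickening_iff.1 hq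
      refine Metric.mem_thickening_iff.2 ⟨z, hz, ?_⟩
      have h1 : dist (f q + u q • (p q - f q)) (f q) < ε / 2 := by
        rw [dist_eq_norm, add_sub_cancel_left, norm_smul, Real.norm_of_nonneg (hu q).1]
        refine lt_of_le_of_lt (mul_le_of_le_one_left (norm_nonneg _) (hu q).2) ?_
        rw [← dist_eq_norm]
        exact (hp q).1
      calc _ ≤ _ := dist_triangle _ (f q) _
        _ < ε / 2 + ε / 2 := add_lt_add h1 hzq
        _ = ε := by ring
    · have : u q = 1 := hu1 hq
      simpa [this] using (hp q).2

theorem isExtensor_cylinder_singleton {M : Type*} [MetricSpace M] [CompactSpace M] {k N : ℕ}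
    (hk : k < N) (x : M) : IsExtensor (nonconstantVectors N) (cylinder k ({x} : Set M)) := by
  intro P f hP hf
  let e : C(Fin k → I, M × (Fin k → I)) := ⟨fun q => (x, q), by fun_prop⟩
  obtain ⟨g, hg, hgK⟩ := exists_eqOn_forall_mem_nonconstantVectors hk (f.comp e)
    (hP.preimage e.continuous) (fun q hq => hf hq)
  obtain ⟨G, hG1, hG2⟩ := exists_continuousMap_eqOn_union hP (isClosed_singleton.cylinder k) f
    (g.comp ⟨Prod.snd, continuous_snd⟩) (by
      rintro ⟨y, q⟩ ⟨hy, hy'⟩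
      obtain rfl : y = x := hy'
      exact (hg hy).symm)
  refine ⟨G, hG1, fun y hy => ?_⟩
  rw [hG2 hy]
  exact hgK _

end Nonconstant

/-! ### Building snakes point by point. -/

section Snakes

open Set Topology

variable {M : Type*}

theorem ContainsSnake.mono {T : LinearOrder M} {U V U' V' : Set M} {s : ℕ}
    (h : ContainsSnake T U V s) (hU : U ⊆ U') (hV : V ⊆ V') : ContainsSnake T U' V' s :=
  let ⟨a, h1, h2, h3⟩ := h
  ⟨a, h1, fun i hi => hU (h2 i hi), fun i hi => hV (h3 i hi)⟩

theorem containsSnake_zero (T : LinearOrder M) {U V : Set M} (hU : U.Nonempty) :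
    ContainsSnake T U V 0 := by
  obtain ⟨x, hx⟩ := hU
  refine ⟨fun _ => x, fun i j hij => ?_, fun _ _ => hx, fun i hi => ?_⟩
  · omega
  · have : i = 0 := Fin.ext (by omega)
    simp [this] at hi

/-- A snake in the part `A` is extended by a point of the part `B` above `A`. -/
theorem ContainsSnake.append {T : LinearOrder M} {U V A B : Set M} {s : ℕ}
    (h : ContainsSnake T (U ∩ A) (V ∩ A) s) (hAB : ∀ a ∈ A, ∀ b ∈ B, T.lt a b)
    (hU : (U ∩ B).Nonempty) (hV : (V ∩ B).Nonempty) :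
    ContainsSnake T (U ∩ (A ∪ B)) (V ∩ (A ∪ B)) (s + 1) := by
  obtain ⟨a, h1, h2, h3⟩ := h
  obtain ⟨u, hu, huB⟩ := hU
  obtain ⟨v, hv, hvB⟩ := hV
  have haA : ∀ i, a i ∈ A := fun i =>
    (Nat.even_or_odd (i : ℕ)).elim (fun hi => (h2 i hi).2) fun hi => (h3 i hi).2
  have hlast : ∀ b ∈ B, ∀ i j : Fin (s + 2), i < j →
      T.lt ((Fin.snoc a b : Fin (s + 2) → M) i) ((Fin.snoc a b : Fin (s + 2) → M) j) := by
    intro b hb i j hij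
    induction j using Fin.lastCases with
    | last =>
      induction i using Fin.lastCases with
      | last => exact absurd hij (lt_irrefl _)
      | cast i => simpa using hAB _ (haA i) _ hb
    | cast j =>
      induction i using Fin.lastCases with
      | last => exact absurd (hij.trans (Fin.castSucc_lt_last j)) (lt_irrefl _)
      | cast i => simpa using h1 i j (by simpa using hij)
  rcases Nat.even_or_odd (s + 1) with hs | hs
  · refine ⟨Fin.snoc a u, hlast u huB, fun i hi => ?_, fun i hi => ?_⟩
    · induction i using Fin.lastCases with
      | last => simpa using ⟨hu, Or.inr huB⟩
      | cast i => simpa using ⟨(h2 i (by simpa using hi)).1, Or.inl (haA i)⟩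
    · induction i using Fin.lastCases with
      | last => exact absurd hs (by simpa using hi)
      | cast i => simpa using ⟨(h3 i (by simpa using hi)).1, Or.inl (haA i)⟩
  · refine ⟨Fin.snoc a v, hlast v hvB, fun i hi => ?_, fun i hi => ?_⟩
    · induction i using Fin.lastCases with
      | last => exact absurd hs (by simpa using hi)
      | cast i => simpa using ⟨(h2 i (by simpa using hi)).1, Or.inl (haA i)⟩
    · induction i using Fin.lastCases with
      | last => simpa using ⟨hv, Or.inr hvB⟩
      | cast i => simpa using ⟨(h3 i (by simpa using hi)).1, Or.inl (haA i)⟩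

/-- If both sets contain points of `A` below any point of `A`, then they contain snakes of every
length in `A`. -/
theorem containsSnake_of_forall_exists_lt {T : LinearOrder M} {U V A : Set M} (hA : A.Nonempty)
    (hU : ∀ c ∈ A, ∃ u ∈ U ∩ A, T.lt u c) (hV : ∀ c ∈ A, ∃ v ∈ V ∩ A, T.lt v c) (s : ℕ) :
    ContainsSnake T (U ∩ A) (V ∩ A) s := by
  have key : ∀ s, ∀ c ∈ A,
      ContainsSnake T (U ∩ (A ∩ {z | T.lt z c})) (V ∩ (A ∩ {z | T.lt z c})) s := by
    intro s
    induction s with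
    | zero =>
      intro c hc
      obtain ⟨u, hu, huc⟩ := hU c hc
      exact containsSnake_zero T ⟨u, hu.1, hu.2, huc⟩
    | succ s ih =>
      intro c hc
      obtain ⟨u, hu, huc⟩ := hU c hc
      obtain ⟨v, hv, hvc⟩ := hV c hc
      have hm : ∃ m ∈ A, T.le m u ∧ T.le m v := by
        rcases le_total u v with h | h
        · exact ⟨u, hu.2, le_rfl, h⟩
        · exact ⟨v, hv.2, h, le_rfl⟩
      obtain ⟨m, hmA, hmu, hmv⟩ := hm
      have := (ih m hmA).append (B := A ∩ {z | T.le m z ∧ T.lt z c})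
        (fun a ha b hb => lt_of_lt_of_le ha.2 hb.2.1) ⟨u, hu.1, hu.2, hmu, huc⟩
        ⟨v, hv.1, hv.2, hmv, hvc⟩
      have hsub : A ∩ {z | T.lt z m} ∪ A ∩ {z | T.le m z ∧ T.lt z c} ⊆ A ∩ {z | T.lt z c} := by
        rintro z (⟨hz, hzm⟩ | ⟨hz, -, hzc⟩)
        · exact ⟨hz, lt_of_lt_of_le hzm (hmu.trans huc.le)⟩
        · exact ⟨hz, hzc⟩
      exact this.mono (inter_subset_inter_right _ hsub) (inter_subset_inter_right _ hsub)
  obtain ⟨c, hc⟩ := hA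
  exact (key s c hc).mono (inter_subset_inter_right _ inter_subset_left)
    (inter_subset_inter_right _ inter_subset_left)

/-- If both sets contain points of `A` above any point of `A`, then they contain snakes of every
length in `A`. -/
theorem containsSnake_of_forall_exists_gt {T : LinearOrder M} {U V A : Set M} (hA : A.Nonempty)
    (hU : ∀ c ∈ A, ∃ u ∈ U ∩ A, T.lt c u) (hV : ∀ c ∈ A, ∃ v ∈ V ∩ A, T.lt c v) (s : ℕ) :
    ContainsSnake T (U ∩ A) (V ∩ A) s := by
  have key : ∀ s, ∃ c ∈ A,
      ContainsSnake T (U ∩ (A ∩ {z | T.le z c})) (V ∩ (A ∩ {z | T.le z c})) s := by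
    intro s
    induction s with
    | zero =>
      obtain ⟨c, hc⟩ := hA
      obtain ⟨u, hu, huc⟩ := hU c hc
      exact ⟨u, hu.2, containsSnake_zero T ⟨u, hu.1, hu.2, le_rfl⟩⟩
    | succ s ih =>
      obtain ⟨c, hc, hs⟩ := ih
      obtain ⟨u, hu, huc⟩ := hU c hc
      obtain ⟨v, hv, hvc⟩ := hV c hc
      have hm : ∃ m ∈ A, T.le u m ∧ T.le v m := by
        rcases le_total u v with h | h
        · exact ⟨v, hv.2, h, le_rfl⟩
        · exact ⟨u, hu.2, le_rfl, h⟩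
      obtain ⟨m, hmA, hmu, hmv⟩ := hm
      have := hs.append (B := A ∩ {z | T.lt c z ∧ T.le z m})
        (fun a ha b hb => lt_of_le_of_lt ha.2 hb.2.1) ⟨u, hu.1, hu.2, huc, hmu⟩
        ⟨v, hv.1, hv.2, hvc, hmv⟩
      have hsub : A ∩ {z | T.le z c} ∪ A ∩ {z | T.lt c z ∧ T.le z m} ⊆ A ∩ {z | T.le z m} := by
        rintro z (⟨hz, hzc⟩ | ⟨hz, -, hzc⟩)
        · exact ⟨hz, hzc.trans (huc.le.trans hmu)⟩
        · exact ⟨hz, hzc⟩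
      exact ⟨m, hmA, this.mono (inter_subset_inter_right _ hsub) (inter_subset_inter_right _ hsub)⟩
  obtain ⟨c, hc, hs⟩ := key s
  exact hs.mono (inter_subset_inter_right _ inter_subset_left)
    (inter_subset_inter_right _ inter_subset_left)

end Snakes

/-! ### From an obstruction to snakes. -/

section Split

open Set Topology unitInterval

variable {M : Type*} [MetricSpace M] [CompactSpace M] {T : LinearOrder M} {k N : ℕ}
  {P : Set (M × (Fin k → I))} {f : C(M × (Fin k → I), Fin (N + 1) → ℝ)} {D : Set M}

/-- A minimal set over which a map does not extend has no isolated points. -/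
theorem exists_mem_ne_of_minimal_not_extendsOver (hk : k < N) (hP : IsClosed P)
    (hf : MapsTo f P (nonconstantVectors N)) (hD : IsClosed D)
    (hness : ¬ ExtendsOver (nonconstantVectors N) P f (cylinder k D))
    (hmin : ∀ D' ⊆ D, IsClosed D' → D' ≠ D →
      ExtendsOver (nonconstantVectors N) P f (cylinder k D'))
    {x : M} (hx : x ∈ D) {W : Set M} (hW : IsOpen W) (hxW : x ∈ W) : ∃ y ∈ D ∩ W, y ≠ x := by
  by_contra! hcon
  apply hness
  have hcl : IsClosed (D \ W) := hD.sdiff hW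
  have h := ExtendsOver.cylinder_union (isOpen_nonconstantVectors N) hcl isClosed_singleton hP hf
    (hmin _ sdiff_subset hcl fun h => ((h.symm.subset hx).2 hxW))
    (isExtensor_cylinder_singleton hk x P f hP hf) (by
      have : D \ W ∩ {x} = ∅ := by
        ext z
        simp only [mem_inter_iff, mem_sdiff, mem_singleton_iff, mem_empty_iff_false, iff_false]
        rintro ⟨⟨-, hz⟩, rfl⟩
        exact hz hxW
      rw [this]
      exact isExtensor_cylinder_empty _ _)
  refine h.mono fun y hy => ?_
  by_cases hyW : y.1 ∈ W
  · exact .inr (hcon _ ⟨hy, hyW⟩)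
  · exact .inl ⟨hy, hyW⟩

-- If neither half were all of `D`, minimality would give extensions over both, and they would glue.
-- If both were, the common part would be `D` itself, which is not an extensor even without the
-- extra interval.
omit [CompactSpace M] in
theorem subset_left_or_subset_right_of_isExtensor (hP : IsClosed P)
    (hf : MapsTo f P (nonconstantVectors N)) (hD : IsClosed D)
    (hness : ¬ ExtendsOver (nonconstantVectors N) P f (cylinder k D))
    (hmin : ∀ D' ⊆ D, IsClosed D' → D' ≠ D →
      ExtendsOver (nonconstantVectors N) P f (cylinder k D'))
    {A B : Set M} (hA : IsClosed A) (hB : IsClosed B) (hAB : D ⊆ A ∪ B)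
    (h : IsExtensor (nonconstantVectors N) (cylinder (k + 1) (D ∩ (A ∩ B)))) :
    (D ⊆ A ∨ D ⊆ B) ∧ ¬ (D ⊆ A ∧ D ⊆ B) := by
  constructor
  · by_contra! hcon
    apply hness
    have := ExtendsOver.cylinder_union (isOpen_nonconstantVectors N) (hD.inter hA) (hD.inter hB)
      hP hf (hmin _ inter_subset_left (hD.inter hA) fun h => hcon.1 (inter_eq_left.1 h))
      (hmin _ inter_subset_left (hD.inter hB) fun h => hcon.2 (inter_eq_left.1 h))
      (by rwa [← inter_inter_distrib_left])
    refine this.mono fun y hy => ?_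
    rw [← inter_union_distrib_left]
    exact ⟨hy, hAB hy⟩
  · rintro ⟨h1, h2⟩
    rw [inter_eq_left.2 (subset_inter h1 h2)] at h
    exact hness (isExtensor_cylinder_of_succ h P f hP hf)

theorem exists_split_or_forall_containsSnake (T : LinearOrder M) (hk : k < N) (hP : IsClosed P)
    (hf : MapsTo f P (nonconstantVectors N)) (hD : IsClosed D)
    (hness : ¬ ExtendsOver (nonconstantVectors N) P f (cylinder k D))
    (hmin : ∀ D' ⊆ D, IsClosed D' → D' ≠ D →
      ExtendsOver (nonconstantVectors N) P f (cylinder k D'))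
    {A : Set M} (hDA : D ⊆ closure A) :
    (∃ J : Set M, (∀ a ∈ J, ∀ b, T.le b a → b ∈ J) ∧
      ¬ IsExtensor (nonconstantVectors N)
        (cylinder (k + 1) (D ∩ (closure (A ∩ J) ∩ closure (A \ J))))) ∨
    ∃ x ∈ D, ∃ y ∈ D, x ≠ y ∧ ∀ ε > 0, ∀ s,
      ContainsSnake T (Metric.ball x ε ∩ A) (Metric.ball y ε ∩ A) s := by
  by_contra! hcon
  obtain ⟨hext, hsnake⟩ := hcon
  have hperf : ∀ x ∈ D, ∀ W : Set M, IsOpen W → x ∈ W → ∃ y ∈ D ∩ W, y ≠ x :=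
    fun x hx W hW hxW => exists_mem_ne_of_minimal_not_extendsOver hk hP hf hD hness hmin hx hW hxW
  have hdich : ∀ J : Set M, (∀ a ∈ J, ∀ b, T.le b a → b ∈ J) →
      (D ⊆ closure (A ∩ J) ∨ D ⊆ closure (A \ J)) ∧
        ¬ (D ⊆ closure (A ∩ J) ∧ D ⊆ closure (A \ J)) := fun J hJ =>
    subset_left_or_subset_right_of_isExtensor hP hf hD hness hmin isClosed_closure
      isClosed_closure (by rwa [← closure_union, inter_union_sdiff]) (hext J hJ)
  have hpair : ∀ O : Set M, IsOpen O → (D ∩ O).Nonempty → ∃ x ∈ D ∩ O, ∃ y ∈ D ∩ O, x ≠ y := by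
    rintro O hO ⟨x, hx⟩
    obtain ⟨y, hy, hyx⟩ := hperf x hx.1 O hO hx.2
    exact ⟨x, hx, y, hy, hyx.symm⟩
  have hmeet : ∀ {x : M} {S : Set M} {ε : ℝ}, x ∈ closure S → 0 < ε →
      ∃ z ∈ Metric.ball x ε, z ∈ S := fun {x S ε} hx hε => by
    obtain ⟨z, hz, hxz⟩ := Metric.mem_closure_iff.1 hx ε hε
    exact ⟨z, Metric.mem_ball'.2 hxz, hz⟩
  -- The union of `F` is the lower side of a Dedekind cut: the initial segments too small to be
  -- dense along `D`.
  let F : Set (Set M) := {J | (∀ a ∈ J, ∀ b, T.le b a → b ∈ J) ∧ ¬ D ⊆ closure (A ∩ J)}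
  have hlow : ∀ a ∈ ⋃₀ F, ∀ b, T.le b a → b ∈ ⋃₀ F := by
    rintro a ⟨J, hJ, ha⟩ b hb
    exact ⟨J, hJ, hJ.1 a ha b hb⟩
  by_cases hF : D ⊆ closure (A ∩ ⋃₀ F)
  · have hF' : ¬ D ⊆ closure (A \ ⋃₀ F) := fun h => (hdich _ hlow).2 ⟨hF, h⟩
    obtain ⟨x₀, hx₀, hx₀'⟩ := not_subset.1 hF'
    have hO : IsOpen (closure (A \ ⋃₀ F))ᶜ := isClosed_closure.isOpen_compl
    -- No segment in `F` suffices although their union does, so the points of `A` near `x` climb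
    -- cofinally in the lower side.
    have hgt : ∀ c ∈ A ∩ ⋃₀ F, ∀ x ∈ D ∩ (closure (A \ ⋃₀ F))ᶜ,
        x ∈ closure ((A ∩ ⋃₀ F) ∩ {z | T.lt c z}) := by
      rintro c ⟨hcA, J, hJ, hcJ⟩ x ⟨hxD, hxO⟩
      have hxJ : x ∈ closure (A \ J) := ((hdich J hJ.1).1.resolve_left hJ.2) hxD
      refine mem_closure_iff.2 fun W hW hxW => ?_
      obtain ⟨z, ⟨hzW, hzO⟩, hzA, hzJ⟩ := mem_closure_iff.1 hxJ _ (hW.inter hO) ⟨hxW, hxO⟩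
      refine ⟨z, hzW, ⟨hzA, ?_⟩, ?_⟩
      · by_contra hz
        exact hzO (subset_closure ⟨hzA, hz⟩)
      · by_contra hz
        exact hzJ (hJ.1 c hcJ z (not_lt.1 hz))
    obtain ⟨x, hx, y, hy, hxy⟩ := hpair _ hO ⟨x₀, hx₀, hx₀'⟩
    obtain ⟨ε, hε, s, hs⟩ := hsnake x hx.1 y hy.1 hxy
    refine hs ((containsSnake_of_forall_exists_gt (A := A ∩ ⋃₀ F) ?_ ?_ ?_ s).mono
      (inter_subset_inter_right _ inter_subset_left) (inter_subset_inter_right _ inter_subset_left))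
    · exact closure_nonempty_iff.1 ⟨x₀, hF hx₀⟩
    · intro c hc
      obtain ⟨z, hz, hzA, hzc⟩ := hmeet (hgt c hc x hx) hε
      exact ⟨z, ⟨hz, hzA⟩, hzc⟩
    · intro c hc
      obtain ⟨z, hz, hzA, hzc⟩ := hmeet (hgt c hc y hy) hε
      exact ⟨z, ⟨hz, hzA⟩, hzc⟩
  · have hF' : D ⊆ closure (A \ ⋃₀ F) := (hdich _ hlow).1.resolve_left hF
    obtain ⟨x₀, hx₀, hx₀'⟩ := not_subset.1 hF
    have hO : IsOpen (closure (A ∩ ⋃₀ F))ᶜ := isClosed_closure.isOpen_compl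
    have hlt : ∀ c ∈ A \ ⋃₀ F, ∀ x ∈ D ∩ (closure (A ∩ ⋃₀ F))ᶜ,
        x ∈ closure ((A \ ⋃₀ F) ∩ {z | T.lt z c}) := by
      rintro c ⟨hcA, hcF⟩ x ⟨hxD, hxO⟩
      have hDc : D ⊆ closure (A ∩ {z | T.le z c}) := by
        by_contra hDc
        exact hcF ⟨_, ⟨fun a ha b hb => le_trans hb ha, hDc⟩, le_refl c⟩
      refine mem_closure_iff.2 fun W hW hxW => ?_
      -- Density is known only for the segment that includes `c`. Since `D` has no isolated points,
      -- `x` can be moved off `c`, which gives strict inequality.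
      have hx' : ∃ x' ∈ D ∩ (W ∩ (closure (A ∩ ⋃₀ F))ᶜ), x' ≠ c := by
        by_cases hxc : x = c
        · exact hxc ▸ hperf x hxD _ (hW.inter hO) ⟨hxW, hxO⟩
        · exact ⟨x, ⟨hxD, hxW, hxO⟩, hxc⟩
      obtain ⟨x', ⟨hxD', hx'W⟩, hxc⟩ := hx'
      obtain ⟨z, ⟨⟨hzW, hzO⟩, hzc⟩, hzA, hzc'⟩ := mem_closure_iff.1 (hDc hxD') _
        ((hW.inter hO).inter isOpen_compl_singleton) ⟨hx'W, hxc⟩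
      refine ⟨z, hzW, ⟨hzA, fun hz => ?_⟩, lt_of_le_of_ne hzc' hzc⟩
      exact hzO (subset_closure ⟨hzA, hz⟩)
    obtain ⟨x, hx, y, hy, hxy⟩ := hpair _ hO ⟨x₀, hx₀, hx₀'⟩
    obtain ⟨ε, hε, s, hs⟩ := hsnake x hx.1 y hy.1 hxy
    refine hs ((containsSnake_of_forall_exists_lt (A := A \ ⋃₀ F) ?_ ?_ ?_ s).mono
      (inter_subset_inter_right _ sdiff_subset) (inter_subset_inter_right _ sdiff_subset))
    · exact closure_nonempty_iff.1 ⟨x₀, hF' hx₀⟩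
    · intro c hc
      obtain ⟨z, hz, hzA, hzc⟩ := hmeet (hlt c hc x hx) hε
      exact ⟨z, ⟨hz, hzA⟩, hzc⟩
    · intro c hc
      obtain ⟨z, hz, hzA, hzc⟩ := hmeet (hlt c hc y hy) hε
      exact ⟨z, ⟨hz, hzA⟩, hzc⟩

/-- A split trades one cube dimension for one snake point: the induction hypothesis gives a snake in
`A ∩ J`, and a point of `A \ J` near `x` or `y` prolongs it. -/
theorem exists_containsSnake_of_not_isExtensor (T : LinearOrder M) {N : ℕ} (m : ℕ) :
    ∀ (k : ℕ) (D A : Set M), k + m < N → IsClosed D →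
      ¬ IsExtensor (nonconstantVectors N) (cylinder k D) → D ⊆ closure A →
      ∃ x ∈ D, ∃ y ∈ D, x ≠ y ∧ ∀ ε > 0,
        ContainsSnake T (Metric.ball x ε ∩ A) (Metric.ball y ε ∩ A) m := by
  induction m with
  | zero =>
    intro k D A hk hD hness hDA
    unfold IsExtensor at hness
    push Not at hness
    obtain ⟨P, f, hP, hf, hness⟩ := hness
    obtain ⟨D', hsub, hD', hness', hmin⟩ :=
      exists_minimal_not_extendsOver (isOpen_nonconstantVectors N) hD hness
    obtain ⟨x, hx⟩ : D'.Nonempty := by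
      by_contra hcon
      rw [not_nonempty_iff_eq_empty.1 hcon] at hness'
      exact hness' (isExtensor_cylinder_empty _ _ P f hP hf)
    obtain ⟨y, hy, hyx⟩ := exists_mem_ne_of_minimal_not_extendsOver (by omega) hP hf hD' hness'
      hmin hx isOpen_univ (mem_univ x)
    refine ⟨x, hsub hx, y, hsub hy.1, hyx.symm, fun ε hε => containsSnake_zero T ?_⟩
    obtain ⟨z, hz, hxz⟩ := Metric.mem_closure_iff.1 (hDA (hsub hx)) ε hε
    exact ⟨z, Metric.mem_ball'.2 hxz, hz⟩
  | succ m ih =>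
    intro k D A hk hD hness hDA
    unfold IsExtensor at hness
    push Not at hness
    obtain ⟨P, f, hP, hf, hness⟩ := hness
    obtain ⟨D', hsub, hD', hness', hmin⟩ :=
      exists_minimal_not_extendsOver (isOpen_nonconstantVectors N) hD hness
    rcases exists_split_or_forall_containsSnake T (by omega) hP hf hD' hness' hmin
      (hsub.trans hDA) with ⟨J, hJ, hness''⟩ | ⟨x, hx, y, hy, hxy, h⟩
    · obtain ⟨x, hx, y, hy, hxy, h⟩ := ih (k + 1) _ (A ∩ J) (by omega)
        (hD'.inter (isClosed_closure.inter isClosed_closure)) hness''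
        (inter_subset_right.trans inter_subset_left)
      refine ⟨x, hsub hx.1, y, hsub hy.1, hxy, fun ε hε => ?_⟩
      have hmeet : ∀ z ∈ closure (A \ J), (Metric.ball z ε ∩ (A \ J)).Nonempty := fun z hz => by
        obtain ⟨w, hw, hzw⟩ := Metric.mem_closure_iff.1 hz ε hε
        exact ⟨w, Metric.mem_ball'.2 hzw, hw⟩
      have := (h ε hε).append (B := A \ J)
        (fun a ha b hb => lt_of_not_ge fun hba => hb.2 (hJ a ha.2 b hba))
        (hmeet x hx.2.2) (hmeet y hy.2.2)
      rwa [inter_union_sdiff] at this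
    · exact ⟨x, hsub hx, y, hsub hy, hxy, fun ε hε => h ε hε _⟩

theorem le_snakeNumber_of_not_isExtensor (T : LinearOrder M) {N m : ℕ} (hm : m < N)
    (h : ¬ IsExtensor (nonconstantVectors N) (cylinder 0 (univ : Set M))) :
    (m : ℕ∞) ≤ snakeNumber M T := by
  obtain ⟨x, -, y, -, hxy, hs⟩ := exists_containsSnake_of_not_isExtensor T m 0 univ univ
    (by omega) isClosed_univ h subset_closure
  refine le_trans ?_ (le_iSup₂_of_le x y (le_iSup_of_le hxy le_rfl))
  exact le_iSup₂_of_le m (fun ε hε => by simpa using hs ε hε) le_rfl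

end Split

/-! ### From extensor properties to covering dimension. -/

section Dimension

open Set Topology unitInterval

variable {M : Type*} [MetricSpace M] {ι : Type*}

/-- The members of the family are continuous nonnegative functions without common zeros. -/
structure IsCoveringFamily (φ : ι → C(M, ℝ)) : Prop where
  nonneg : ∀ i x, 0 ≤ φ i x
  exists_pos : ∀ x, ∃ i, 0 < φ i x

/-- Regard `φ` as a map to a nerve of dimension at most N. On the closed simplex `S` it is replaced
by a map to the boundary, keeping its values over the boundary: extend the coordinates to a
nonconstant vector, then subtract the minimum. -/
theorem exists_coveringFamily_eliminate {N : ℕ}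
    (hM : IsExtensor (nonconstantVectors N) (cylinder 0 (univ : Set M)))
    {φ : ι → C(M, ℝ)} (hφ : IsCoveringFamily φ)
    (hcard : ∀ τ : Finset ι, τ.card = N + 2 → ∀ x, ∃ i ∈ τ, φ i x = 0)
    (S : Finset ι) (hS : S.card = N + 1) :
    ∃ ψ : ι → C(M, ℝ), IsCoveringFamily ψ ∧ (∀ i x, φ i x = 0 → ψ i x = 0) ∧
      ∀ x, ∃ i ∈ S, ψ i x = 0 := by
  classical
  have hM' : IsExtensor (nonconstantVectors N) (univ : Set M) :=
    hM.of_leftInverse ⟨fun x => (x, 0), by fun_prop⟩ ⟨Prod.fst, continuous_fst⟩ (fun _ => rfl)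
      fun x _ => mem_univ x
  let e : S ≃ Fin (N + 1) := S.equivFinOfCardEq hS
  -- `A` is the preimage of the closed simplex `S`, `B` that of the complement of its open simplex.
  let A : Set M := {x | ∀ i ∉ S, φ i x = 0}
  let B : Set M := {x | ∃ i ∈ S, φ i x = 0}
  have hA : IsClosed A := by
    simp only [A, ofPred_forall]
    exact isClosed_iInter fun i => isClosed_iInter fun _ =>
      isClosed_eq (φ i).continuous continuous_const
  have hB : IsClosed B := by
    have : B = ⋃ i ∈ S, {x | φ i x = 0} := by ext; simp [B]
    rw [this]
    exact S.finite_toSet.isClosed_biUnion fun i _ => isClosed_eq (φ i).continuous continuous_const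
  have hpos : ∀ x ∉ B, ∀ i ∈ S, 0 < φ i x := fun x hx i hi =>
    lt_of_le_of_ne (hφ.nonneg i x) fun h => hx ⟨i, hi, h.symm⟩
  have hAB : ∀ x ∉ B, x ∈ A := by
    intro x hx i hi
    obtain ⟨j, hj, hj0⟩ := hcard (insert i S) (by rw [Finset.card_insert_of_notMem hi, hS]) x
    rcases Finset.mem_insert.1 hj with rfl | hj
    · exact hj0
    · exact absurd hj0 (hpos x hx j hj).ne'
  let f : C(M, Fin (N + 1) → ℝ) := ⟨fun x j => φ (e.symm j) x, by fun_prop⟩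
  have hf : MapsTo f (A ∩ B) (nonconstantVectors N) := by
    rintro x ⟨hxA, i, hi, hi0⟩
    obtain ⟨j, hj⟩ := hφ.exists_pos x
    have hjS : j ∈ S := by
      by_contra hjS
      exact hj.ne' (hxA j hjS)
    refine ⟨e ⟨i, hi⟩, e ⟨j, hjS⟩, ?_⟩
    simpa [f, hi0] using hj.ne
  obtain ⟨g, hgf, hgK⟩ := hM' _ f (hA.inter hB) hf
  let μ : C(M, ℝ) := ⟨fun x => Finset.univ.inf' Finset.univ_nonempty fun j => g x j, by
    refine Continuous.finset_inf'_apply _ fun j _ => ?_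
    fun_prop⟩
  have hμle : ∀ x j, μ x ≤ g x j := fun x j => Finset.inf'_le _ (Finset.mem_univ j)
  have hμmem : ∀ x, ∃ j, μ x = g x j := fun x => by
    obtain ⟨j, -, hj⟩ := Finset.exists_mem_eq_inf' Finset.univ_nonempty fun j => g x j
    exact ⟨j, hj⟩
  have hμ0 : ∀ x ∈ A ∩ B, μ x = 0 := by
    intro x hx
    obtain ⟨j, hj⟩ := hμmem x
    obtain ⟨i, hi, hi0⟩ := hx.2
    apply le_antisymm
    · have := hμle x (e ⟨i, hi⟩)
      simpa [hgf hx, f, hi0] using this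
    · rw [hj, hgf hx]
      exact hφ.nonneg _ _
  let f₁ : C(M, ι → ℝ) :=
    ⟨fun x i => if hi : i ∈ S then g x (e ⟨i, hi⟩) - μ x else φ i x, by
      refine continuous_pi fun i => ?_
      by_cases hi : i ∈ S
      · simp only [hi, dif_pos]; fun_prop
      · simp only [hi]; exact (φ i).continuous⟩
  let f₂ : C(M, ι → ℝ) := ⟨fun x i => φ i x, by fun_prop⟩
  have hf₁ : ∀ x (j : Fin (N + 1)), f₁ x (e.symm j) = g x j - μ x := fun x j => by simp [f₁]
  have hf₁' : ∀ x, ∀ i ∉ S, f₁ x i = φ i x := fun x i hi => by simp [f₁, hi]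
  obtain ⟨F, hFA, hFB⟩ := exists_continuousMap_eqOn_union hA hB f₁ f₂ (by
    intro x hx
    funext i
    by_cases hi : i ∈ S
    · have := hf₁ x (e ⟨i, hi⟩)
      rw [e.symm_apply_apply] at this
      rw [this, hμ0 x hx, hgf hx]
      simp [f, f₂]
    · exact hf₁' x i hi)
  have hf₁nonneg : ∀ x i, 0 ≤ f₁ x i := by
    intro x i
    by_cases hi : i ∈ S
    · have := hf₁ x (e ⟨i, hi⟩)
      rw [e.symm_apply_apply] at this
      rw [this, sub_nonneg]
      exact hμle _ _
    · rw [hf₁' x i hi]; exact hφ.nonneg _ _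
  have hcases : ∀ x, (x ∈ B ∧ F x = f₂ x) ∨ (x ∉ B ∧ x ∈ A ∧ F x = f₁ x) := fun x => by
    by_cases hx : x ∈ B
    · exact .inl ⟨hx, hFB hx⟩
    · exact .inr ⟨hx, hAB x hx, hFA (hAB x hx)⟩
  refine ⟨fun i => ⟨fun x => F x i, by fun_prop⟩, ⟨fun i x => ?_, fun x => ?_⟩,
    fun i x h0 => ?_, fun x => ?_⟩
  · show 0 ≤ F x i
    rcases hcases x with ⟨-, h⟩ | ⟨-, -, h⟩
    · rw [h]; exact hφ.nonneg _ _
    · rw [h]; exact hf₁nonneg x i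
  · show ∃ i, 0 < F x i
    rcases hcases x with ⟨-, h⟩ | ⟨-, -, h⟩
    · rw [h]; exact hφ.exists_pos x
    · rw [h]
      obtain ⟨a, b, hab⟩ := hgK (mem_univ x)
      have : ∃ j, μ x < g x j := by
        by_contra! hcon
        exact hab (((hcon a).antisymm (hμle x a)).trans ((hcon b).antisymm (hμle x b)).symm)
      obtain ⟨j, hj⟩ := this
      exact ⟨e.symm j, by rw [hf₁]; exact sub_pos.2 hj⟩
  · show F x i = 0
    rcases hcases x with ⟨-, h⟩ | ⟨hxB, -, h⟩
    · rw [h]; exact h0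
    · rw [h, hf₁' x i fun hi => (hpos x hxB i hi).ne' h0, h0]
  · show ∃ i ∈ S, F x i = 0
    rcases hcases x with ⟨⟨i, hi, hi0⟩, h⟩ | ⟨-, -, h⟩
    · exact ⟨i, hi, by rw [h]; exact hi0⟩
    · obtain ⟨j, hj⟩ := hμmem x
      exact ⟨e.symm j, (e.symm j).2, by rw [h, hf₁, hj, sub_self]⟩

/-- Zeros persist under elimination, so simplices already removed never return. -/
theorem exists_coveringFamily_pred [Finite ι] {N : ℕ}
    (hM : IsExtensor (nonconstantVectors N) (cylinder 0 (univ : Set M)))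
    {φ : ι → C(M, ℝ)} (hφ : IsCoveringFamily φ)
    (hcard : ∀ τ : Finset ι, τ.card = N + 2 → ∀ x, ∃ i ∈ τ, φ i x = 0) :
    ∃ ψ : ι → C(M, ℝ), IsCoveringFamily ψ ∧ (∀ i x, φ i x = 0 → ψ i x = 0) ∧
      ∀ S : Finset ι, S.card = N + 1 → ∀ x, ∃ i ∈ S, ψ i x = 0 := by
  classical
  have := Fintype.ofFinite ι
  have key : ∀ 𝒮 : Finset (Finset ι), (∀ S ∈ 𝒮, S.card = N + 1) →
      ∃ ψ : ι → C(M, ℝ), IsCoveringFamily ψ ∧ (∀ i x, φ i x = 0 → ψ i x = 0) ∧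
        ∀ S ∈ 𝒮, ∀ x, ∃ i ∈ S, ψ i x = 0 := by
    intro 𝒮
    induction 𝒮 using Finset.induction_on with
    | empty => exact fun _ => ⟨φ, hφ, fun _ _ h => h, by simp⟩
    | insert S 𝒮 hS ih =>
      intro h𝒮
      obtain ⟨ψ, hψ, hφψ, hψ𝒮⟩ := ih fun τ hτ => h𝒮 τ (Finset.mem_insert_of_mem hτ)
      obtain ⟨χ, hχ, hψχ, hχS⟩ := exists_coveringFamily_eliminate hM hψ
        (fun τ hτ x => let ⟨i, hi, h⟩ := hcard τ hτ x; ⟨i, hi, hφψ i x h⟩) S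
        (h𝒮 S (Finset.mem_insert_self _ _))
      refine ⟨χ, hχ, fun i x h => hψχ i x (hφψ i x h), fun τ hτ x => ?_⟩
      rcases Finset.mem_insert.1 hτ with rfl | hτ
      · exact hχS x
      · obtain ⟨i, hi, h⟩ := hψ𝒮 τ hτ x
        exact ⟨i, hi, hψχ i x h⟩
  obtain ⟨ψ, h1, h2, h3⟩ := key (Finset.powersetCard (N + 1) Finset.univ)
    fun S hS => (Finset.mem_powersetCard.1 hS).2
  exact ⟨ψ, h1, h2, fun S hS => h3 S (Finset.mem_powersetCard.2 ⟨Finset.subset_univ _, hS⟩)⟩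

theorem exists_coveringFamily_of_isExtensor [Finite ι] {m : ℕ}
    (hM : ∀ N, m ≤ N → IsExtensor (nonconstantVectors N) (cylinder 0 (univ : Set M)))
    {φ : ι → C(M, ℝ)} (hφ : IsCoveringFamily φ) :
    ∃ ψ : ι → C(M, ℝ), IsCoveringFamily ψ ∧ (∀ i x, φ i x = 0 → ψ i x = 0) ∧
      ∀ S : Finset ι, S.card = m + 1 → ∀ x, ∃ i ∈ S, ψ i x = 0 := by
  have := Fintype.ofFinite ι
  have key : ∀ d : ℕ, (∃ ψ : ι → C(M, ℝ), IsCoveringFamily ψ ∧ (∀ i x, φ i x = 0 → ψ i x = 0) ∧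
      ∀ S : Finset ι, S.card = m + d + 1 → ∀ x, ∃ i ∈ S, ψ i x = 0) →
      ∃ ψ : ι → C(M, ℝ), IsCoveringFamily ψ ∧ (∀ i x, φ i x = 0 → ψ i x = 0) ∧
      ∀ S : Finset ι, S.card = m + 1 → ∀ x, ∃ i ∈ S, ψ i x = 0 := by
    intro d
    induction d with
    | zero => exact fun h => h
    | succ d ih =>
      rintro ⟨ψ, h1, h2, h3⟩
      obtain ⟨χ, h4, h5, h6⟩ := exists_coveringFamily_pred (hM (m + d) (by omega)) h1 h3
      exact ih ⟨χ, h4, fun i x h => h5 i x (h2 i x h), h6⟩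
  -- No index set has this many elements, so the descent starts vacuously.
  refine key (Fintype.card ι) ⟨φ, hφ, fun _ _ h => h, fun S hS => ?_⟩
  have := S.card_le_univ
  omega

theorem coveringDimLE_of_isExtensor {m : ℕ}
    (hM : ∀ N, m ≤ N → IsExtensor (nonconstantVectors N) (cylinder 0 (univ : Set M))) :
    CoveringDimLE M ((m : ℕ∞) : WithBot ℕ∞) := by
  classical
  intro A hA
  have := hA.finite.to_subtype
  have hopen : ∀ i : A, IsClosed ((i : Set M)ᶜ) := fun i => (hA.isOpen _ i.2).isClosed_compl
  -- The constant 1 serves the member `univ`, where the distance to the empty complement would be 0.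
  let φ : A → C(M, ℝ) := fun i => if h : ((i : Set M)ᶜ).Nonempty then
    ⟨fun x => Metric.infDist x (i : Set M)ᶜ, by fun_prop⟩ else ContinuousMap.const _ 1
  have hφ0 : ∀ (i : A) x, x ∉ (i : Set M) → φ i x = 0 := fun i x hx => by
    have : ((i : Set M)ᶜ).Nonempty := ⟨x, hx⟩
    simp only [φ, this, dif_pos]
    exact Metric.infDist_zero_of_mem hx
  have hφ : IsCoveringFamily φ := by
    refine ⟨fun i x => ?_, fun x => ?_⟩
    · by_cases h : ((i : Set M)ᶜ).Nonempty
      · simp only [φ, h, dif_pos]; exact Metric.infDist_nonneg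
      · simp [φ, h]
    · obtain ⟨U, hU, hxU⟩ : x ∈ ⋃₀ A := hA.covers ▸ mem_univ x
      refine ⟨⟨U, hU⟩, ?_⟩
      by_cases h : (Uᶜ).Nonempty
      · simp only [φ, h, dif_pos]
        exact ((hopen ⟨U, hU⟩).notMem_iff_infDist_pos h).1 fun h => h hxU
      · simp [φ, h]
  obtain ⟨ψ, hψ, hφψ, hψm⟩ := exists_coveringFamily_of_isExtensor hM hφ
  refine ⟨range fun i => {x | 0 < ψ i x}, ⟨finite_range _, ?_, ?_⟩, ?_, ?_⟩
  · rintro _ ⟨i, rfl⟩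
    exact isOpen_lt continuous_const (ψ i).continuous
  · refine eq_univ_of_forall fun x => ?_
    obtain ⟨i, hi⟩ := hψ.exists_pos x
    exact ⟨_, ⟨i, rfl⟩, hi⟩
  · rintro _ ⟨i, rfl⟩
    refine ⟨i, i.2, fun x hx => ?_⟩
    by_contra hxi
    exact (ne_of_gt hx) (hφψ i x (hφ0 i x hxi))
  · refine iSup₂_le fun n hn => ?_
    obtain ⟨F, hF, hFn, x, hx⟩ := hn
    obtain ⟨i₀, -⟩ := hψ.exists_pos x
    have : Nonempty A := ⟨i₀⟩
    have hF' : ∀ U ∈ F, ∃ i, {x | 0 < ψ i x} = U := fun U hU => hF hU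
    choose! i hi using hF'
    have hinj : Set.InjOn i F := fun U hU V hV h => by
      rw [← hi U hU, ← hi V hV, h]
    have hle : F.card ≤ m := by
      by_contra! hcon
      obtain ⟨S, hS, hSm⟩ := Finset.exists_subset_card_eq
        (show m + 1 ≤ (F.image i).card by rw [Finset.card_image_of_injOn hinj]; exact hcon)
      obtain ⟨j, hj, hj0⟩ := hψm S hSm x
      obtain ⟨U, hU, rfl⟩ := Finset.mem_image.1 (hS hj)
      have : x ∈ {x | 0 < ψ (i U) x} := (hi U hU).symm ▸ hx U hU
      exact (ne_of_gt this) hj0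
    exact_mod_cast (by omega : n ≤ m)

theorem coveringDim_lt_top_of_snakeNumber_lt_top [CompactSpace M] (T : LinearOrder M) (h : snakeNumber M T < ⊤) :
    coveringDim M < ⊤ := by
  obtain ⟨s, hs⟩ := ENat.ne_top_iff_exists.1 h.ne
  refine lt_of_le_of_lt (sInf_le (coveringDimLE_of_isExtensor (m := s + 2) fun N hN => ?_)) ?_
  · by_contra hcon
    have := le_snakeNumber_of_not_isExtensor T (m := s + 1) (by omega) hcon
    rw [← hs] at this
    have : s + 1 ≤ s := by exact_mod_cast this
    omega
  · rw [← WithBot.coe_top, WithBot.coe_lt_coe]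
    exact ENat.natCast_lt_top _

end Dimension

/-! ### From finite dimension to a lexicographic order. -/

section CodeOrder

open Set Topology Filter

theorem exists_coveringDimLE_of_lt_top {X : Type*} [TopologicalSpace X] (h : coveringDim X < ⊤) :
    ∃ n : ℕ, CoveringDimLE X ((n : ℕ∞) : WithBot ℕ∞) := by
  obtain ⟨d, hd, hdt⟩ := sInf_lt_iff.1 h
  have hle : ∃ n : ℕ, d ≤ ((n : ℕ∞) : WithBot ℕ∞) := by
    induction d using WithBot.recBotCoe with
    | bot => exact ⟨0, bot_le⟩
    | coe d =>
      rw [← WithBot.coe_top, WithBot.coe_lt_coe] at hdt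
      obtain ⟨n, rfl⟩ := ENat.ne_top_iff_exists.1 hdt.ne
      exact ⟨n, le_rfl⟩
  obtain ⟨n, hn⟩ := hle
  refine ⟨n, fun A hA => ?_⟩
  obtain ⟨B, hB, hBA, hBd⟩ := hd A hA
  exact ⟨B, hB, hBA, hBd.trans hn⟩

theorem card_le_of_familyOrder_le {X : Type*} {B : Set (Set X)} {n : ℕ}
    (h : familyOrder B ≤ ((n : ℕ∞) : WithBot ℕ∞)) {F : Finset (Set X)} (hF : (F : Set (Set X)) ⊆ B)
    {x : X} (hx : ∀ V ∈ F, x ∈ V) : F.card ≤ n + 1 := by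
  rcases Nat.eq_zero_or_pos F.card with h0 | h0
  · omega
  · have := (le_iSup₂_of_le (F.card - 1) ⟨F, hF, by omega, x, hx⟩ le_rfl).trans h
    have : F.card - 1 ≤ n := by exact_mod_cast this
    omega

variable {M : Type*} [MetricSpace M]

theorem exists_finite_cover_of_coveringDimLE [CompactSpace M] {n : ℕ}
    (h : CoveringDimLE M ((n : ℕ∞) : WithBot ℕ∞)) {ε : ℝ} (hε : 0 < ε) :
    ∃ (B : Set (Set M)) (ρ : ℝ), 0 < ρ ∧ B.Finite ∧ (∀ x, ∃ V ∈ B, Metric.ball x ρ ⊆ V) ∧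
      (∀ V ∈ B, ∀ x ∈ V, ∀ y ∈ V, dist x y < ε) ∧
      ∀ x, ∀ F : Finset (Set M), (F : Set (Set M)) ⊆ B → (∀ V ∈ F, x ∈ V) → F.card ≤ n + 1 := by
  obtain ⟨t, -, htf, ht⟩ := finite_cover_balls_of_compact (isCompact_univ (X := M)) (half_pos hε)
  obtain ⟨B, hB, hBA, hBn⟩ := h ((fun x => Metric.ball x (ε / 2)) '' t)
    ⟨htf.image _, by rintro _ ⟨x, -, rfl⟩; exact Metric.isOpen_ball, by
      rw [sUnion_image]; exact univ_subset_iff.1 ht⟩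
  obtain ⟨ρ, hρ, hρB⟩ := lebesgue_number_lemma_of_metric_sUnion (isCompact_univ (X := M)) hB.isOpen
    hB.covers.ge
  refine ⟨B, ρ, hρ, hB.finite, fun x => hρB x (mem_univ x), fun V hV x hx y hy => ?_,
    fun x F hF hx => card_le_of_familyOrder_le hBn hF hx⟩
  obtain ⟨_, ⟨z, -, rfl⟩, hVz⟩ := hBA V hV
  calc dist x y ≤ dist x z + dist y z := dist_triangle_right _ _ _
    _ < ε / 2 + ε / 2 := add_lt_add (hVz hx) (hVz hy)
    _ = ε := by ring

/-- In a sequence of nonempty finite sets with maps between them, given points at every level have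
a compatible sequence of cluster points. -/
theorem exists_compatible_sequence {α : Type*} (S : ℕ → Set α) (hS : ∀ i, (S i).Finite)
    (hne : ∀ i, (S i).Nonempty) (φ : ℕ → α → α) (hφ : ∀ i, MapsTo (φ i) (S (i + 1)) (S i)) :
    ∃ c : ℕ → α, (∀ i, c i ∈ S i) ∧ ∀ i, φ i (c (i + 1)) = c i := by
  choose v hv using hne
  -- `D d i` carries level `i + d` down to level `i`; an ultrafilter then selects one limit value
  -- per level, compatibly.
  let D : ℕ → ℕ → α → α := fun d => Nat.rec (fun _ a => a) (fun _ D i a => φ i (D (i + 1) a)) d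
  have hD : ∀ d i a, D (d + 1) i a = φ i (D d (i + 1) a) := fun _ _ _ => rfl
  have hDS : ∀ d i, ∀ a ∈ S (i + d), D d i a ∈ S i := by
    intro d
    induction d with
    | zero => exact fun i a ha => ha
    | succ d ih =>
      intro i a ha
      rw [hD]
      exact hφ i (ih (i + 1) a (by rwa [show i + 1 + d = i + (d + 1) by omega]))
  let e : ℕ → ℕ → α := fun i j => D (j - i) i (v j)
  have he : ∀ i j, i + 1 ≤ j → φ i (e (i + 1) j) = e i j := by
    intro i j hij
    simp only [e]
    rw [← hD, show j - (i + 1) + 1 = j - i by omega]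
  have heS : ∀ i j, i ≤ j → e i j ∈ S i := fun i j hij =>
    hDS _ _ _ (by rw [Nat.add_sub_cancel' hij]; exact hv j)
  have hlarge : ∀ i, ∀ᶠ j in (hyperfilter ℕ : Filter ℕ), i ≤ j := fun i =>
    Nat.hyperfilter_le_atTop (eventually_ge_atTop i)
  have hc : ∀ i, ∃ a ∈ S i, ∀ᶠ j in (hyperfilter ℕ : Filter ℕ), e i j = a := fun i => by
    rw [← Ultrafilter.eventually_exists_mem_iff (hS i)]
    filter_upwards [hlarge i] with j hj
    exact ⟨_, heS i j hj, rfl⟩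
  choose c hcS hc using hc
  refine ⟨c, hcS, fun i => ?_⟩
  obtain ⟨j, h1, h2, h3⟩ := ((hc i).and ((hc (i + 1)).and (hlarge (i + 1)))).exists
  rw [← h1, ← h2, he i j h3]

/-- If `dim M ≤ n`, there are finite covers of multiplicity at most `n + 1` and vanishing mesh,
with a compatible choice of members around every point. -/
theorem exists_codes [CompactSpace M] [Nonempty M] {n : ℕ}
    (h : CoveringDimLE M ((n : ℕ∞) : WithBot ℕ∞)) :
    ∃ (B : ℕ → Set (Set M)) (r : ℕ → ℝ) (c : M → ℕ → Set M), (∀ i, (B i).Finite) ∧ (∀ i, 0 < r i) ∧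
      (∀ x i, c x i ∈ B i) ∧ (∀ x i, Metric.ball x (r i) ⊆ c x i) ∧
      (∀ x y i, c x (i + 1) = c y (i + 1) → c x i = c y i) ∧
      (∀ x y, x ≠ y → ∃ i, ∀ V ∈ B i, x ∈ V → y ∉ V) ∧
      ∀ i x, ∀ F : Finset (Set M), (F : Set (Set M)) ⊆ B i → (∀ V ∈ F, x ∈ V) →
        F.card ≤ n + 1 := by
  choose! B ρ hρ hfin hleb hmesh hcard using
    fun (ε : ℝ) (hε : 0 < ε) => exists_finite_cover_of_coveringDimLE h hε
  -- The next mesh is at most half the Lebesgue number, so the half-Lebesgue neighbourhood of a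
  -- member fits in one member of the previous cover. This parent depends on the member alone, so
  -- equal codes stay equal at lower levels.
  let ε : ℕ → ℝ := fun i => Nat.rec 1 (fun _ e => min (e / 2) (ρ e / 2)) i
  have hεs : ∀ i, ε (i + 1) = min (ε i / 2) (ρ (ε i) / 2) := fun _ => rfl
  have hε : ∀ i, 0 < ε i := by
    intro i
    induction i with
    | zero => exact one_pos
    | succ i ih => rw [hεs]; exact lt_min (half_pos ih) (half_pos (hρ _ ih))
  have hεle : ∀ i, ε i ≤ (1 / 2) ^ i := by
    intro i
    induction i with
    | zero => simp [ε]
    | succ i ih =>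
      rw [hεs, pow_succ]
      exact (min_le_left _ _).trans (by linarith)
  have hφ : ∀ i, ∀ V ∈ B (ε (i + 1)), ∃ U ∈ B (ε i),
      ∀ v ∈ V, Metric.ball v (ρ (ε i) / 2) ⊆ U := by
    intro i V hV
    rcases V.eq_empty_or_nonempty with rfl | ⟨w, hw⟩
    · obtain ⟨U, hU, -⟩ := hleb (ε i) (hε i) (Classical.arbitrary M)
      exact ⟨U, hU, by simp⟩
    · obtain ⟨U, hU, hwU⟩ := hleb (ε i) (hε i) w
      refine ⟨U, hU, fun v hv => (Metric.ball_subset_ball' ?_).trans hwU⟩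
      have h1 := hmesh _ (hε (i + 1)) V hV v hv w hw
      have h2 : ε (i + 1) ≤ ρ (ε i) / 2 := min_le_right _ _
      linarith
  choose! φ hφB hφ using hφ
  have hcode : ∀ x : M, ∃ c : ℕ → Set M,
      (∀ i, c i ∈ {V ∈ B (ε i) | Metric.ball x (ρ (ε i) / 2) ⊆ V}) ∧
        ∀ i, φ i (c (i + 1)) = c i := fun x => by
    refine exists_compatible_sequence _ (fun i => (hfin _ (hε i)).subset (sep_subset _ _))
      (fun i => ?_) φ fun i V hV => ⟨hφB i V hV.1, hφ i V hV.1 x ?_⟩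
    · obtain ⟨V, hV, hxV⟩ := hleb _ (hε i) x
      exact ⟨V, hV, (Metric.ball_subset_ball (half_le_self (hρ _ (hε i)).le)).trans hxV⟩
    · exact hV.2 (Metric.mem_ball_self (half_pos (hρ _ (hε (i + 1)))))
  choose c hc hcφ using hcode
  refine ⟨fun i => B (ε i), fun i => ρ (ε i) / 2, c, fun i => hfin _ (hε i),
    fun i => half_pos (hρ _ (hε i)), fun x i => (hc x i).1, fun x i => (hc x i).2,
    fun x y i hxy => ?_, fun x y hxy => ?_, fun i => hcard _ (hε i)⟩
  · rw [← hcφ x, ← hcφ y, hxy]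
  · obtain ⟨i, hi⟩ := exists_pow_lt_of_lt_one (dist_pos.2 hxy) (by norm_num : (1 / 2 : ℝ) < 1)
    refine ⟨i, fun V hV hx hy => ?_⟩
    have := hmesh _ (hε i) V hV x hx y hy
    linarith [hεle i]

theorem Pi.apply_eq_of_toLex_le_of_toLex_le {a b d : ℕ → ℕ} (hab : toLex a ≤ toLex b)
    (hbd : toLex b ≤ toLex d) {i : ℕ} (h : ∀ j ≤ i, a j = d j) : ∀ j ≤ i, b j = a j := by
  intro j
  induction j using Nat.strong_induction_on with
  | _ j ih =>
    intro hj
    have h1 : a j ≤ b j := Pi.apply_le_of_toLex hab fun l hl => (ih l hl (by omega)).symm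
    have h2 : b j ≤ d j := Pi.apply_le_of_toLex hbd fun l hl => by
      rw [ih l hl (by omega), h l (by omega)]
    have := h j hj
    omega

omit [MetricSpace M] in
/-- Compatible codes give a lexicographic order in which all points with a common code at some
level form an order-convex set. -/
theorem exists_linearOrder_ordConnected {c : M → ℕ → Set M} {B : ℕ → Set (Set M)}
    (hB : ∀ i, (B i).Finite) (hcB : ∀ x i, c x i ∈ B i)
    (hc : ∀ x y i, c x (i + 1) = c y (i + 1) → c x i = c y i)
    (hinj : ∀ x y, (∀ i, c x i = c y i) → x = y) :
    ∃ T : LinearOrder M, ∀ x y z i, T.le x y → T.le y z → c x i = c z i → c y i = c x i := by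
  choose f hf using fun i => Set.countable_iff_exists_injOn.1 (hB i).countable
  have hcode : ∀ x y i, f i (c x i) = f i (c y i) ↔ c x i = c y i := fun x y i =>
    ⟨fun h => hf i (hcB x i) (hcB y i) h, fun h => by rw [h]⟩
  let code : M → Lex (ℕ → ℕ) := fun x => toLex fun i => f i (c x i)
  have hcodeinj : Function.Injective code := fun x y hxy => hinj x y fun i =>
    (hcode x y i).1 (congrFun (toLex.injective hxy) i)
  refine ⟨LinearOrder.lift' code hcodeinj, fun x y z i hxy hyz hxz => ?_⟩
  have hdown : ∀ d i, c x (i + d) = c z (i + d) → c x i = c z i := by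
    intro d
    induction d with
    | zero => exact fun i h => h
    | succ d ih => exact fun i h => ih i (hc x z _ h)
  exact (hcode y x i).1 (Pi.apply_eq_of_toLex_le_of_toLex_le hxy hyz (fun j hj => by
    rw [hdown (i - j) j (by rwa [Nat.add_sub_cancel' hj])]) i le_rfl)

theorem exists_snakeNumber_lt_top [CompactSpace M] (h : coveringDim M < ⊤) :
    ∃ T : LinearOrder M, snakeNumber M T < ⊤ := by
  classical
  obtain ⟨n, hn⟩ := exists_coveringDimLE_of_lt_top h
  cases isEmpty_or_nonempty M with
  | inl hM =>
    exact ⟨LinearOrder.lift' (fun x : M => (hM.elim x : ℕ)) fun x => hM.elim x,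
      by simp [snakeNumber]⟩
  | inr hM =>
  obtain ⟨B, r, c, hB, hr, hcB, hcr, hc, hsep, hcard⟩ := exists_codes hn
  have hmem : ∀ {x y : M} {i : ℕ}, y ∈ Metric.ball x (r i) → x ∈ c y i := fun {x y i} hy =>
    hcr y i (Metric.mem_ball_comm.1 hy)
  obtain ⟨T, hT⟩ := exists_linearOrder_ordConnected hB hcB hc fun x y hxy => by
    by_contra hne
    obtain ⟨i, hi⟩ := hsep x y hne
    refine hi _ (hcB x i) (hmem (Metric.mem_ball_self (hr i))) ?_
    rw [hxy i]
    exact hmem (Metric.mem_ball_self (hr i))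
  refine ⟨T, lt_of_le_of_lt (iSup₂_le fun x y => iSup_le fun hxy => iSup₂_le fun s hs => ?_)
    (ENat.natCast_lt_top (2 * n + 1))⟩
  obtain ⟨i, hi⟩ := hsep x y hxy
  obtain ⟨a, ha, hax, hay⟩ := hs (r i) (hr i)
  by_contra! hcon
  have hs : 2 * n + 1 < s := by exact_mod_cast hcon
  -- The members at the even points; the last index 2n + 2 is at most `s`.
  let g : Fin (n + 2) → Set M := fun j => c (a ⟨2 * j, by omega⟩) i
  have hxg : ∀ j, x ∈ g j := fun j => hmem (hax _ (by simp))
  have hg : Function.Injective g := by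
    have hlt : ∀ j l : Fin (n + 2), j < l → g j ≠ g l := by
      intro j l hjl hgj
      have hjl' : (j : ℕ) < l := hjl
      let p : Fin (s + 1) := ⟨2 * j + 1, by omega⟩
      have hp := hT _ (a p) _ i (ha ⟨2 * j, by omega⟩ p (by simp [p, Fin.lt_def])).le
        (ha p ⟨2 * l, by omega⟩ (by simp only [p, Fin.lt_def]; omega)).le hgj
      have hyp : y ∈ c (a p) i := hmem (hay p ⟨j, rfl⟩)
      rw [hp] at hyp
      exact hi _ (hcB _ i) (hxg j) hyp
    intro j l hjl
    rcases lt_trichotomy j l with h | h | h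
    · exact absurd hjl (hlt _ _ h)
    · exact h
    · exact absurd hjl.symm (hlt _ _ h)
  have := hcard i x (Finset.univ.image g)
    (by
      intro V hV
      obtain ⟨j, -, rfl⟩ := Finset.mem_image.1 (Finset.mem_coe.1 hV)
      exact hcB _ _)
    (by
      intro V hV
      obtain ⟨j, -, rfl⟩ := Finset.mem_image.1 hV
      exact hxg j)
  rw [Finset.card_image_of_injective _ hg, Finset.card_univ, Fintype.card_fin] at this
  omega

end CodeOrder

theorem theorem1 (M : Type*) [MetricSpace M] [CompactSpace M] :
    coveringDim M < ⊤ ↔ ∃ T : LinearOrder M, snakeNumber M T < ⊤ :=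
  ⟨exists_snakeNumber_lt_top, fun ⟨T, hT⟩ => coveringDim_lt_top_of_snakeNumber_lt_top T hT⟩
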